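/- An information graph $G=(V,E,\alpha)$ is a finite connected simple graph $(V,E)$ together with a sampling probability $\alpha\in[0,1]$. The proximity of two vertices $u,v$ in $G$ is the probability that $u$ and $v$ are connected in the random graph obtained from $G$ by keeping each edge independently with probability $\alpha$, and the broadcast of $G$ is the minimum proximity over all pairs of vertices. For an integer $k\ge 0$, let $\beta^*=\beta^*(G,k)$ be the maximum broadcast of $(V,E\cup F,\alpha)$ over all sets $F$ of at most $k$ new edges (pairs of distinct vertices not in $E$). Assume that algorithms have access to an oracle which returns, in one step, the proximity in $G$ of any two vertices of the input graph $G$. Then there is a polynomial-time algorithm (a single program, whose number of steps is bounded by a fixed polynomial in $|V|$) which, given any information graph $G=(V,E,\alpha)$ and any integer $k\ge 0$, outputs a set $F$ of at most $k$ new edges such that the broadcast of $(V,E\cup F,\alpha)$ is at least $$\frac{(\beta^*)^4\,\alpha^2}{16^{k+1}}.$$ Here an algorithm is a random access program (with assignments, sequencing, branching and while-loops) that adds, subtracts, compares, stores and loads natural numbers, queries the adjacency of two vertices of $G$, and copies and compares real numbers, namely $\alpha$ and oracle answers; each instruction, test and oracle call is one step. -/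

import Mathlib

namespace BroadcastImprovement

/-! ### Information graphs, proximity, broadcast -/

/-- An information graph on `V`: a connected graph and a sampling probability `α`. -/
structure InformationGraph (V : Type*) where
  graph : SimpleGraph V
  connected : graph.Connected
  α : ℝ
  α_nonneg : 0 ≤ α
  α_le_one : α ≤ 1

namespace InformationGraph

variable {V : Type*}

/-- `G + F`: the graph `G` with the edges of `F` added and the same sampling probability. -/
def addEdges (G : InformationGraph V) (F : Finset (Sym2 V)) : InformationGraph V where
  graph := G.graph ⊔ SimpleGraph.fromEdgeSet (F : Set (Sym2 V))
  connected := G.connected.mono le_sup_left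
  α := G.α
  α_nonneg := G.α_nonneg
  α_le_one := G.α_le_one

variable [Fintype V]

open Classical in
/-- The probability that exactly the edges in `S` survive when every edge of `G` is kept
independently with probability `α` (meant for `S` a set of edges of `G`). -/
noncomputable def sampleProb (G : InformationGraph V) (S : Finset (Sym2 V)) : ℝ :=
  G.α ^ S.card * (1 - G.α) ^ (G.graph.edgeFinset \ S).card

open Classical in
/-- The proximity of `u` and `v`: the probability that `u` and `v` are connected in a graph
sampled from `G`. -/
noncomputable def proximity (G : InformationGraph V) (u v : V) : ℝ :=
  ∑ S ∈ G.graph.edgeFinset.powerset,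
    if (SimpleGraph.fromEdgeSet (S : Set (Sym2 V))).Reachable u v then G.sampleProb S else 0

/-- The broadcast of `G`: the minimum of the proximity over all pairs of vertices. (As
`proximity v v = 1`, the diagonal pairs matter only for a one-vertex graph.) -/
noncomputable def broadcast (G : InformationGraph V) : ℝ :=
  ⨅ p : V × V, G.proximity p.1 p.2

/-- The optimum broadcast achievable by adding (at most) `k` new edges to `G`; the supremum is
over a finite nonempty family. -/
noncomputable def optBroadcast (G : InformationGraph V) (k : ℕ) : ℝ :=
  ⨆ F : {F : Finset (Sym2 V) // (F : Set (Sym2 V)) ⊆ G.graphᶜ.edgeSet ∧ F.card ≤ k},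
    (G.addEdges F.1).broadcast

end InformationGraph

/-! ### Random access programs with a proximity oracle

A program works on natural-number registers, a random-access memory of natural numbers, and
real registers, and writes a list of pairs of numbers. Natural numbers can only be added,
subtracted and compared, and real numbers can only be obtained from the input `α` or from the
oracle, copied and compared. Each instruction, each oracle call and each evaluation of a test
costs one step. -/

/-- Basic instructions; `x y z` are indices of natural registers, `a b` of real registers. -/
inductive Instr
  /-- `x := c` -/
  | const (x c : ℕ)
  /-- `x := y` -/
  | move (x y : ℕ)
  /-- `x := y + z` -/
  | add (x y z : ℕ)
  /-- `x := y - z` (truncated) -/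
  | sub (x y z : ℕ)
  /-- `x := mem[y]` -/
  | load (x y : ℕ)
  /-- `mem[x] := y` -/
  | store (x y : ℕ)
  /-- `x := 1` if `y` and `z` are adjacent vertices of the input graph, else `x := 0` -/
  | adj (x y z : ℕ)
  /-- oracle call: `a :=` proximity of the vertices `y` and `z` in the input graph -/
  | prox (a y z : ℕ)
  /-- `a := b` on real registers -/
  | moveReal (a b : ℕ)
  /-- append the pair `(x, y)` to the output -/
  | emit (x y : ℕ)

/-- Tests: comparison of two natural registers or of two real registers. -/
inductive Test
  | lt (x y : ℕ)
  | eq (x y : ℕ)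
  | ltReal (a b : ℕ)

/-- Programs: finite syntax trees, independent of the input. -/
inductive Program
  | skip
  | instr (i : Instr)
  | seq (P Q : Program)
  | ite (b : Test) (P Q : Program)
  | while (b : Test) (P : Program)

structure State where
  reg : ℕ → ℕ
  mem : ℕ → ℕ
  real : ℕ → ℝ
  out : List (ℕ × ℕ)

variable {n : ℕ}

open Classical in
/-- Adjacency of numbers as vertices of a graph on `{0, …, n - 1}`; `0` out of range. -/
noncomputable def adjQuery (G : InformationGraph (Fin n)) (u v : ℕ) : ℕ :=
  if ∃ (hu : u < n) (hv : v < n), G.graph.Adj ⟨u, hu⟩ ⟨v, hv⟩ then 1 else 0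

/-- The oracle: proximity in `G` of numbers as vertices of `G`; `0` out of range. -/
noncomputable def proxQuery (G : InformationGraph (Fin n)) (u v : ℕ) : ℝ :=
  if h : u < n ∧ v < n then G.proximity ⟨u, h.1⟩ ⟨v, h.2⟩ else 0

/-- Effect of a basic instruction on input graph `G`. -/
noncomputable def Instr.apply (G : InformationGraph (Fin n)) (s : State) : Instr → State
  | .const x c => { s with reg := Function.update s.reg x c }
  | .move x y => { s with reg := Function.update s.reg x (s.reg y) }
  | .add x y z => { s with reg := Function.update s.reg x (s.reg y + s.reg z) }
  | .sub x y z => { s with reg := Function.update s.reg x (s.reg y - s.reg z) }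
  | .load x y => { s with reg := Function.update s.reg x (s.mem (s.reg y)) }
  | .store x y => { s with mem := Function.update s.mem (s.reg x) (s.reg y) }
  | .adj x y z => { s with reg := Function.update s.reg x (adjQuery G (s.reg y) (s.reg z)) }
  | .prox a y z => { s with real := Function.update s.real a (proxQuery G (s.reg y) (s.reg z)) }
  | .moveReal a b => { s with real := Function.update s.real a (s.real b) }
  | .emit x y => { s with out := s.out ++ [(s.reg x, s.reg y)] }

def Test.Holds (s : State) : Test → Prop
  | .lt x y => s.reg x < s.reg y
  | .eq x y => s.reg x = s.reg y
  | .ltReal a b => s.real a < s.real b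

/-- `Exec G P s t s'`: on input graph `G`, the program `P` started in state `s` halts in state
`s'` after exactly `t` steps. -/
inductive Exec (G : InformationGraph (Fin n)) : Program → State → ℕ → State → Prop
  | skip (s : State) : Exec G .skip s 0 s
  | instr (i : Instr) (s : State) : Exec G (.instr i) s 1 (i.apply G s)
  | seq {P Q : Program} {s s' s'' : State} {t t' : ℕ} :
      Exec G P s t s' → Exec G Q s' t' s'' → Exec G (.seq P Q) s (t + t') s''
  | ite_true {b : Test} {P Q : Program} {s s' : State} {t : ℕ} :
      b.Holds s → Exec G P s t s' → Exec G (.ite b P Q) s (t + 1) s'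
  | ite_false {b : Test} {P Q : Program} {s s' : State} {t : ℕ} :
      ¬ b.Holds s → Exec G Q s t s' → Exec G (.ite b P Q) s (t + 1) s'
  | while_false {b : Test} {P : Program} {s : State} :
      ¬ b.Holds s → Exec G (.while b P) s 1 s
  | while_true {b : Test} {P : Program} {s s' s'' : State} {t t' : ℕ} :
      b.Holds s → Exec G P s t s' → Exec G (.while b P) s' t' s'' →
      Exec G (.while b P) s (t + t' + 1) s''

/-- The initial state on an instance `(G, k)`: register `0` holds the number of vertices,
register `1` holds `k`, real register `0` holds `α`; everything else is zero or empty. -/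
def initState (G : InformationGraph (Fin n)) (k : ℕ) : State where
  reg := Function.update (Function.update (fun _ => 0) 0 n) 1 k
  mem := fun _ => 0
  real := Function.update (fun _ => 0) 0 G.α
  out := []

/-- The list `out` lists, as pairs of vertex numbers, exactly the edges of `F`. -/
def Lists (out : List (ℕ × ℕ)) (F : Finset (Sym2 (Fin n))) : Prop :=
  ∃ L : List (Fin n × Fin n),
    out = L.map (fun e => ((e.1 : ℕ), (e.2 : ℕ))) ∧
    F = (L.map (fun e => s(e.1, e.2))).toFinset

/-- On the instance `(G, k)`, the program `P` halts after exactly `t` steps and outputs the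
edge set `F`. -/
def Program.Outputs (P : Program) (G : InformationGraph (Fin n)) (k t : ℕ)
    (F : Finset (Sym2 (Fin n))) : Prop :=
  ∃ s : State, Exec G P (initState G k) t s ∧ Lists s.out F

end BroadcastImprovement

open BroadcastImprovement

/-! The algorithm is a farthest-first traversal. Starting from vertex `0`, it repeatedly takes as
new center a vertex of least proximity to its nearest center, and links each new center to vertex
`0`. Let `r` be the least proximity of a vertex to its nearest center at the end. Every vertex
reaches the hub with probability at least `r * α`, via its center and one edge, so Harris'
inequality gives broadcast at least `r ^ 2 * α ^ 2` (`le_broadcast_addEdges_star`).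

It remains to bound `r` from below. The `k + 1` centers and a farthest vertex are `k + 2` vertices
with pairwise proximities at most `r`. On the other hand, among any `k + 2` vertices two have
proximity at least `(β* / 2 ^ k) ^ 2` (`exists_sq_le_of_union`). To see this, take an optimal set of
new edges and one root, to which every vertex has proximity at least `β*`. Delete the new edges one
at a time. Each deletion is compensated by making one end of the edge a root, at the cost of a
factor two (`exists_root_of_insert`). At most `k + 1` roots result, so two of the `k + 2` vertices
share a root, and the multiplicative triangle inequality applies.

The factor two rests on `prox_insert_le`, proved by conditioning on the cluster of a vertex and by
Harris' inequality. Running only `min k n` rounds makes the time independent of `k`. -/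

namespace BroadcastImprovement

/-! ### Expectations over random subsets of a finite set -/

section Expectation

variable {σ : Type*} [DecidableEq σ]

/-- The expectation of `f` over a random subset of `E` that contains each element independently
with probability `α`. -/
noncomputable def expect (α : ℝ) (E : Finset σ) (f : Finset σ → ℝ) : ℝ :=
  ∑ S ∈ E.powerset, α ^ S.card * (1 - α) ^ (E \ S).card * f S

theorem expect_empty (α : ℝ) (f : Finset σ → ℝ) : expect α ∅ f = f ∅ := by
  simp [expect]

theorem expect_insert (α : ℝ) {E : Finset σ} {e : σ} (he : e ∉ E) (f : Finset σ → ℝ) :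
    expect α (insert e E) f =
      (1 - α) * expect α E f + α * expect α E (fun S => f (insert e S)) := by
  unfold expect
  rw [Finset.sum_powerset_insert he, Finset.mul_sum, Finset.mul_sum]
  congr 1
  · refine Finset.sum_congr rfl fun S hS => ?_
    have heS : e ∉ S := fun h => he (Finset.mem_powerset.1 hS h)
    rw [Finset.insert_sdiff_of_notMem _ heS,
      Finset.card_insert_of_notMem (fun h => he (Finset.mem_sdiff.1 h).1)]
    ring
  · refine Finset.sum_congr rfl fun S hS => ?_
    have heS : e ∉ S := fun h => he (Finset.mem_powerset.1 hS h)
    have : insert e E \ insert e S = E \ S := by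
      ext x
      simp only [Finset.mem_sdiff, Finset.mem_insert]
      constructor
      · tauto
      · rintro ⟨h1, h2⟩
        exact ⟨Or.inr h1, fun h => h.elim (fun h => he (h ▸ h1)) h2⟩
    rw [Finset.card_insert_of_notMem heS, this]
    ring

theorem expect_add (α : ℝ) (E : Finset σ) (f g : Finset σ → ℝ) :
    expect α E (fun S => f S + g S) = expect α E f + expect α E g := by
  simp [expect, mul_add, Finset.sum_add_distrib]

theorem expect_sub (α : ℝ) (E : Finset σ) (f g : Finset σ → ℝ) :
    expect α E (fun S => f S - g S) = expect α E f - expect α E g := by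
  simp [expect, mul_sub, Finset.sum_sub_distrib]

theorem expect_sum {ι : Type*} (α : ℝ) (E : Finset σ) (s : Finset ι)
    (f : ι → Finset σ → ℝ) :
    expect α E (fun S => ∑ i ∈ s, f i S) = ∑ i ∈ s, expect α E (f i) := by
  simp only [expect, Finset.mul_sum]
  exact Finset.sum_comm

variable {α : ℝ}

theorem expect_mono (h0 : 0 ≤ α) (h1 : α ≤ 1) {E : Finset σ} {f g : Finset σ → ℝ}
    (h : ∀ S, f S ≤ g S) : expect α E f ≤ expect α E g := by
  refine Finset.sum_le_sum fun S _ => mul_le_mul_of_nonneg_left (h S) ?_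
  have : 0 ≤ 1 - α := by linarith
  positivity

theorem expect_const (E : Finset σ) (c : ℝ) : expect α E (fun _ => c) = c := by
  induction E using Finset.induction_on with
  | empty => exact expect_empty _ _
  | insert e E he ih => rw [expect_insert _ he, ih]; ring

theorem expect_nonneg (h0 : 0 ≤ α) (h1 : α ≤ 1) {E : Finset σ} {f : Finset σ → ℝ}
    (h : ∀ S, 0 ≤ f S) : 0 ≤ expect α E f :=
  (expect_const (α := α) E 0).symm.le.trans (expect_mono h0 h1 h)

theorem monotone_comp_insert {f : Finset σ → ℝ} (hf : Monotone f) (e : σ) :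
    Monotone fun S => f (insert e S) :=
  fun _ _ h => hf (Finset.insert_subset_insert e h)

/-- Harris' inequality. -/
theorem expect_mul_le_of_monotone (h0 : 0 ≤ α) (h1 : α ≤ 1) (E : Finset σ) :
    ∀ {f g : Finset σ → ℝ}, Monotone f → Monotone g →
      expect α E f * expect α E g ≤ expect α E (fun S => f S * g S) := by
  induction E using Finset.induction_on with
  | empty => intro f g _ _; simp [expect_empty]
  | insert e E he ih =>
    intro f g hf hg
    rw [expect_insert _ he, expect_insert _ he, expect_insert _ he]
    have i0 := ih hf hg
    have i1 := ih (monotone_comp_insert hf e) (monotone_comp_insert hg e)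
    have mf : expect α E f ≤ expect α E (fun S => f (insert e S)) :=
      expect_mono h0 h1 fun S => hf (Finset.subset_insert e S)
    have mg : expect α E g ≤ expect α E (fun S => g (insert e S)) :=
      expect_mono h0 h1 fun S => hg (Finset.subset_insert e S)
    have h2 : 0 ≤ 1 - α := by linarith
    have j0 := mul_le_mul_of_nonneg_left i0 h2
    have j1 := mul_le_mul_of_nonneg_left i1 h0
    -- Averaging over the state of `e` leaves exactly this covariance term: `α (1 - α)` times the
    -- product of the increments of the two means.
    have j2 := mul_nonneg (mul_nonneg h0 h2) (mul_nonneg (sub_nonneg.2 mf) (sub_nonneg.2 mg))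
    linarith

/-- Functions that depend on disjoint sets of elements are independent. -/
theorem expect_mul_of_disjoint_support (A : Set σ) (E : Finset σ) :
    ∀ {f g : Finset σ → ℝ}, (∀ e ∉ A, ∀ S, f (insert e S) = f S) →
      (∀ e ∈ A, ∀ S, g (insert e S) = g S) →
      expect α E (fun S => f S * g S) = expect α E f * expect α E g := by
  induction E using Finset.induction_on with
  | empty => intro f g _ _; simp [expect_empty]
  | insert e E he ih =>
    intro f g hf hg
    rw [expect_insert _ he, expect_insert _ he, expect_insert _ he, ih hf hg]
    by_cases h : e ∈ A
    · simp only [hg e h]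
      rw [ih (f := fun S => f (insert e S)) (fun e' h' S => by rw [Finset.insert_comm, hf e' h']) hg]
      ring
    · simp only [hf e h]
      rw [ih (g := fun S => g (insert e S)) hf (fun e' h' S => by rw [Finset.insert_comm, hg e' h'])]
      ring

theorem expect_le_expect_of_subset (h0 : 0 ≤ α) (h1 : α ≤ 1) {E E' : Finset σ} (h : E ⊆ E')
    {f : Finset σ → ℝ} (hf : Monotone f) : expect α E f ≤ expect α E' f := by
  -- Writing the larger set as `E' ∪ E` frees `E'` for induction.
  rw [← Finset.union_eq_right.2 h, Finset.union_comm]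
  clear h
  induction E' using Finset.induction_on with
  | empty => simp
  | insert e E' he ih =>
    by_cases h : e ∈ E' ∪ E
    · rwa [Finset.insert_union, Finset.insert_eq_of_mem h]
    · rw [Finset.insert_union, expect_insert _ h]
      have : expect α (E' ∪ E) f ≤ expect α (E' ∪ E) (fun S => f (insert e S)) :=
        expect_mono h0 h1 fun S => hf (Finset.subset_insert e S)
      nlinarith

end Expectation

/-! ### Reachability in graphs given by edge sets -/

section Reach

variable {V : Type*}

/-- `u` and `v` are connected by edges from `S`. -/
def Joined (S : Finset (Sym2 V)) (u v : V) : Prop :=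
  (SimpleGraph.fromEdgeSet (S : Set (Sym2 V))).Reachable u v

namespace Joined

variable {S S' : Finset (Sym2 V)} {u v w : V}

theorem refl (S : Finset (Sym2 V)) (u : V) : Joined S u u := SimpleGraph.Reachable.refl u

theorem symm (h : Joined S u v) : Joined S v u := SimpleGraph.Reachable.symm h

theorem trans (h : Joined S u v) (h' : Joined S v w) : Joined S u w :=
  SimpleGraph.Reachable.trans h h'

theorem mono (hS : S ⊆ S') (h : Joined S u v) : Joined S' u v :=
  SimpleGraph.Reachable.mono (SimpleGraph.fromEdgeSet_mono (by exact_mod_cast hS)) h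

theorem of_mem (h : s(u, v) ∈ S) : Joined S u v := by
  by_cases huv : u = v
  · subst huv; exact refl S u
  · exact SimpleGraph.Adj.reachable ((SimpleGraph.fromEdgeSet_adj _).2 ⟨by exact_mod_cast h, huv⟩)

/-- A set that contains `u` and is closed along the edges of `S` contains all vertices joined to
`u`. -/
theorem induction {P : V → Prop} (h : Joined S u v) (hu : P u)
    (step : ∀ w w', Joined S u w → P w → s(w, w') ∈ S → P w') : P v := by
  have h' := (SimpleGraph.reachable_iff_reflTransGen u v).1 h
  have : Joined S u v ∧ P v := by
    clear h
    induction h' with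
    | refl => exact ⟨refl S u, hu⟩
    | @tail w w' _ hw ih =>
      have hm : s(w, w') ∈ S := by
        exact_mod_cast ((SimpleGraph.fromEdgeSet_adj _).1 hw).1
      exact ⟨ih.1.trans (of_mem hm), step w w' ih.1 ih.2 hm⟩
  exact this.2

/-- The three alternatives together are stable under every further step, including repeated
crossings of the new edge, so no simple path has to be extracted. -/
theorem of_insert [DecidableEq (Sym2 V)] {a b : V} (h : Joined (insert s(a, b) S) u v) :
    Joined S u v ∨ (Joined S u a ∧ Joined S b v) ∨ (Joined S u b ∧ Joined S a v) := by
  refine h.induction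
    (P := fun v => Joined S u v ∨ (Joined S u a ∧ Joined S b v) ∨ (Joined S u b ∧ Joined S a v))
    (Or.inl (refl S u)) fun w w' _ ih hm => ?_
  rcases Finset.mem_insert.1 hm with h | h
  · rcases Sym2.eq_iff.1 h with ⟨rfl, rfl⟩ | ⟨rfl, rfl⟩
    · rcases ih with h | h | h
      · exact Or.inr (Or.inl ⟨h, refl S _⟩)
      · exact Or.inr (Or.inl ⟨h.1, refl S _⟩)
      · exact Or.inl h.1
    · rcases ih with h | h | h
      · exact Or.inr (Or.inr ⟨h, refl S _⟩)
      · exact Or.inl h.1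
      · exact Or.inr (Or.inr ⟨h.1, refl S _⟩)
  · have := of_mem h
    rcases ih with h | h | h
    · exact Or.inl (h.trans this)
    · exact Or.inr (Or.inl ⟨h.1, h.2.trans this⟩)
    · exact Or.inr (Or.inr ⟨h.1, h.2.trans this⟩)

/-- Adding an edge that avoids the set `C` does not affect whether `C` is the cluster of `u`. -/
theorem cluster_insert_iff [DecidableEq (Sym2 V)] {e : Sym2 V} {C : Set V}
    (he : ∀ x ∈ e, x ∉ C) :
    {w | Joined (insert e S) u w} = C ↔ {w | Joined S u w} = C := by
  have key : ∀ w w', w ∈ C → s(w, w') ∈ insert e S → s(w, w') ∈ S := by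
    intro w w' hw hm
    rcases Finset.mem_insert.1 hm with h | h
    · exact absurd hw (he w (h ▸ Sym2.mem_mk_left w w'))
    · exact h
  constructor
  · rintro rfl
    ext w
    refine ⟨fun h => h.mono (Finset.subset_insert _ _), fun h => ?_⟩
    exact induction h (refl S u) fun w w' hw ih hm => ih.trans (of_mem (key w w' hw hm))
  · rintro rfl
    ext w
    refine ⟨fun h => ?_, fun h => h.mono (Finset.subset_insert _ _)⟩
    exact induction h (refl S u) fun w w' _ ih hm => ih.trans (of_mem (key w w' ih hm))

end Joined

end Reach

/-! ### Proximity with respect to an edge set -/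

section Prox

variable {V : Type*}

open Classical in
/-- The indicator of a proposition as a real number. -/
noncomputable def ind (p : Prop) : ℝ := if p then 1 else 0

theorem ind_of_true {p : Prop} (h : p) : ind p = 1 := if_pos h

theorem ind_of_false {p : Prop} (h : ¬ p) : ind p = 0 := if_neg h

theorem ind_nonneg (p : Prop) : 0 ≤ ind p := by unfold ind; split_ifs <;> simp

theorem ind_le_one (p : Prop) : ind p ≤ 1 := by unfold ind; split_ifs <;> simp

theorem ind_le_ind {p q : Prop} (h : p → q) : ind p ≤ ind q := by
  by_cases hp : p
  · rw [ind_of_true hp, ind_of_true (h hp)]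
  · rw [ind_of_false hp]; exact ind_nonneg q

theorem ind_and (p q : Prop) : ind (p ∧ q) = ind p * ind q := by
  by_cases hp : p <;> by_cases hq : q <;> simp [ind, hp, hq]

theorem ind_or_le (p q : Prop) : ind (p ∨ q) ≤ ind p + ind q := by
  by_cases hp : p <;> by_cases hq : q <;> simp [ind, hp, hq]

theorem monotone_ind_joined (u v : V) :
    Monotone fun S : Finset (Sym2 V) => ind (Joined S u v) :=
  fun _ _ h => ind_le_ind fun h' => h'.mono h

variable [DecidableEq (Sym2 V)]

/-- The probability that `u` and `v` are joined by the surviving edges of `E`. -/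
noncomputable def prox (α : ℝ) (E : Finset (Sym2 V)) (u v : V) : ℝ :=
  expect α E fun S => ind (Joined S u v)

variable {α : ℝ} {E : Finset (Sym2 V)}

theorem prox_symm (u v : V) : prox α E u v = prox α E v u := by
  unfold prox
  congr 1
  ext S
  exact congrArg ind (propext ⟨Joined.symm, Joined.symm⟩)

theorem prox_self (u : V) : prox α E u u = 1 := by
  unfold prox
  simp only [ind_of_true (Joined.refl _ u)]
  exact expect_const _ _

theorem prox_nonneg (h0 : 0 ≤ α) (h1 : α ≤ 1) (u v : V) : 0 ≤ prox α E u v :=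
  expect_nonneg h0 h1 fun _ => ind_nonneg _

theorem prox_le_one (h0 : 0 ≤ α) (h1 : α ≤ 1) (u v : V) : prox α E u v ≤ 1 :=
  (expect_mono h0 h1 fun _ => ind_le_one _).trans (expect_const _ _).le

theorem prox_mono (h0 : 0 ≤ α) (h1 : α ≤ 1) {E' : Finset (Sym2 V)} (h : E ⊆ E') (u v : V) :
    prox α E u v ≤ prox α E' u v :=
  expect_le_expect_of_subset h0 h1 h (monotone_ind_joined u v)

/-! ### Correlation inequalities and the effect of new edges -/

theorem prox_mul_le_expect_and (h0 : 0 ≤ α) (h1 : α ≤ 1) (u v x y : V) :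
    prox α E u v * prox α E x y ≤ expect α E fun S => ind (Joined S u v ∧ Joined S x y) := by
  simp only [ind_and]
  exact expect_mul_le_of_monotone h0 h1 E (monotone_ind_joined u v) (monotone_ind_joined x y)

/-- Multiplicative triangle inequality, from Harris: proximity behaves like the exponential of a
negative distance. -/
theorem prox_mul_le (h0 : 0 ≤ α) (h1 : α ≤ 1) (u v w : V) :
    prox α E u v * prox α E v w ≤ prox α E u w :=
  (prox_mul_le_expect_and h0 h1 u v v w).trans
    (expect_mono h0 h1 fun _ => ind_le_ind fun h => h.1.trans h.2)

theorem le_prox_of_mem (h0 : 0 ≤ α) (h1 : α ≤ 1) {u v : V} (h : s(u, v) ∈ E) :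
    α ≤ prox α E u v := by
  refine le_trans ?_ (prox_mono h0 h1 (Finset.singleton_subset_iff.2 h) u v)
  have h' : insert s(u, v) (∅ : Finset (Sym2 V)) = {s(u, v)} := rfl
  rw [← h', prox, expect_insert _ (Finset.notMem_empty _), expect_empty, expect_empty,
    ind_of_true (Joined.of_mem (Finset.mem_insert_self _ _))]
  have := ind_nonneg (Joined ∅ u v)
  nlinarith

/-- Conditioned on the cluster of `v` missing `r`, connections to `r` are no more likely. -/
theorem expect_cluster_le [Finite V] (h0 : 0 ≤ α) (h1 : α ≤ 1) (v a b r : V) :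
    (expect α E fun S => ind ((Joined S v a ∧ ¬ Joined S v r) ∧ Joined S b r)) ≤
      (expect α E fun S => ind (Joined S v a ∧ ¬ Joined S v r)) * prox α E b r := by
  classical
  have := Fintype.ofFinite V
  -- The event is split according to the cluster `C` of `v`; `off C` keeps the edges that do not
  -- touch `C`.
  let T : Finset (Set V) := Finset.univ.filter fun C => a ∈ C ∧ r ∉ C
  let f : Set V → Finset (Sym2 V) → ℝ := fun C S => ind ({w | Joined S v w} = C)
  let off : Set V → Finset (Sym2 V) → Finset (Sym2 V) :=
    fun C S => S.filter fun e => ∀ x ∈ e, x ∉ C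
  let g : Set V → Finset (Sym2 V) → ℝ := fun C S => ind (Joined (off C S) b r)
  have hmem : ∀ S, Joined S v a ∧ ¬ Joined S v r → {w | Joined S v w} ∈ T := fun S h =>
    Finset.mem_filter.2 ⟨Finset.mem_univ _, h⟩
  have hsum : ∀ S, ind (Joined S v a ∧ ¬ Joined S v r) = ∑ C ∈ T, f C S := by
    intro S
    by_cases h : Joined S v a ∧ ¬ Joined S v r
    · rw [ind_of_true h, Finset.sum_eq_single {w | Joined S v w}]
      · exact (ind_of_true rfl).symm
      · intro C _ hC; exact ind_of_false fun h => hC h.symm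
      · intro hC
        exact absurd (hmem S h) hC
    · rw [ind_of_false h]
      refine (Finset.sum_eq_zero fun C hC => ind_of_false ?_).symm
      rintro rfl
      exact h (Finset.mem_filter.1 hC).2
  have hle : ∀ S, ind ((Joined S v a ∧ ¬ Joined S v r) ∧ Joined S b r) ≤
      ∑ C ∈ T, f C S * g C S := by
    intro S
    by_cases h : (Joined S v a ∧ ¬ Joined S v r) ∧ Joined S b r
    · rw [ind_of_true h]
      refine le_trans ?_ (Finset.single_le_sum
        (fun C _ => mul_nonneg (ind_nonneg _) (ind_nonneg _)) (hmem S h.1))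
      -- A walk from `r` never enters the cluster of `v`, because `r` lies outside it.
      have hoff : Joined (off {w | Joined S v w} S) r b := by
        refine h.2.symm.induction (P := Joined (off {w | Joined S v w} S) r)
          (Joined.refl _ _) fun w w' hw ih hm => ih.trans (Joined.of_mem ?_)
        refine Finset.mem_filter.2 ⟨hm, fun x hx hxC => ?_⟩
        rcases Sym2.mem_iff.1 hx with rfl | rfl
        · exact h.1.2 (Joined.trans hxC hw.symm)
        · exact h.1.2 ((Joined.trans hxC (Joined.of_mem hm).symm).trans hw.symm)
      have e1 : f {w | Joined S v w} S = 1 := ind_of_true rfl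
      have e2 : g {w | Joined S v w} S = 1 := ind_of_true hoff.symm
      change 1 ≤ f _ S * g _ S
      rw [e1, e2, one_mul]
    · rw [ind_of_false h]
      exact Finset.sum_nonneg fun C _ => mul_nonneg (ind_nonneg _) (ind_nonneg _)
  -- Whether the cluster is `C` depends only on edges touching `C`, while `g C` depends only on the
  -- others.
  have hind : ∀ C, expect α E (fun S => f C S * g C S) = expect α E (f C) * expect α E (g C) := by
    intro C
    refine expect_mul_of_disjoint_support {e | ¬ ∀ x ∈ e, x ∉ C} E ?_ ?_
    · intro e he S
      exact congrArg ind (propext (Joined.cluster_insert_iff (not_not.1 he)))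
    · intro e he S
      have : off C (insert e S) = off C S := by
        simp only [off, Finset.filter_insert, if_neg he]
      simp only [g, this]
  have hg : ∀ C, expect α E (g C) ≤ prox α E b r := fun C =>
    expect_mono h0 h1 fun S => ind_le_ind fun h => h.mono (Finset.filter_subset _ _)
  calc _ ≤ expect α E (fun S => ∑ C ∈ T, f C S * g C S) := expect_mono h0 h1 hle
    _ = ∑ C ∈ T, expect α E (f C) * expect α E (g C) := by
      rw [expect_sum]; exact Finset.sum_congr rfl fun C _ => hind C
    _ ≤ ∑ C ∈ T, expect α E (f C) * prox α E b r :=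
      Finset.sum_le_sum fun C _ =>
        mul_le_mul_of_nonneg_left (hg C) (expect_nonneg h0 h1 fun _ => ind_nonneg _)
    _ = _ := by
      rw [← Finset.sum_mul, ← expect_sum]
      simp only [← hsum]

/-- When `v` is joined to `a`, being joined to `r` means the same for both. Subtract the probability
that `v`, `a` and `r` are all joined, which Harris bounds below. -/
theorem expect_joined_not_joined_le (h0 : 0 ≤ α) (h1 : α ≤ 1) (v a r : V) :
    (expect α E fun S => ind (Joined S v a ∧ ¬ Joined S v r)) ≤
      prox α E v a * (1 - prox α E a r) := by
  have h : (fun S : Finset (Sym2 V) => ind (Joined S v a ∧ ¬ Joined S v r)) =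
      fun S => ind (Joined S v a) - ind (Joined S v a ∧ Joined S a r) := by
    ext S
    by_cases ha : Joined S v a
    · have : Joined S a r ↔ Joined S v r := ⟨ha.trans, ha.symm.trans⟩
      by_cases hr : Joined S v r <;> simp [ind, ha, hr, this]
    · simp [ind, ha]
  rw [h, expect_sub]
  have := prox_mul_le_expect_and (E := E) h0 h1 v a a r
  unfold prox at *
  linarith

/-- The effect of a new edge on the proximity of `v` and `r`. -/
theorem prox_insert_le [Finite V] (h0 : 0 ≤ α) (h1 : α ≤ 1) {a b : V} (he : s(a, b) ∉ E)
    (v r : V) :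
    prox α (insert s(a, b) E) v r ≤ prox α E v r +
      prox α E v a * (1 - prox α E a r) * prox α E b r + prox α E v b * prox α E a r := by
  have key : expect α E (fun S => ind (Joined (insert s(a, b) S) v r)) ≤ prox α E v r +
      prox α E v a * (1 - prox α E a r) * prox α E b r + prox α E v b * prox α E a r := by
    have hle : ∀ S : Finset (Sym2 V), ind (Joined (insert s(a, b) S) v r) ≤
        ind (Joined S v r) + ind ((Joined S v a ∧ ¬ Joined S v r) ∧ Joined S b r) +
          ind ((Joined S v b ∧ ¬ Joined S v r) ∧ Joined S a r) := by
      intro S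
      refine le_trans (ind_le_ind ?_) ((ind_or_le _ _).trans (add_le_add_left (ind_or_le _ _) _))
      intro h
      have := h.of_insert
      tauto
    refine (expect_mono h0 h1 hle).trans ?_
    rw [expect_add, expect_add]
    have ha := expect_cluster_le (E := E) h0 h1 v a b r
    have hb := expect_cluster_le (E := E) h0 h1 v b a r
    have ha' := mul_le_mul_of_nonneg_right (expect_joined_not_joined_le (E := E) h0 h1 v a r)
      (prox_nonneg (E := E) h0 h1 b r)
    -- Here the condition of missing `r` is dropped. The factor `1 - prox α E a r` in the other term
    -- is what later makes the two weights sum to one.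
    have hb' := mul_le_mul_of_nonneg_right
      (expect_mono (E := E) h0 h1 fun S => ind_le_ind fun h : Joined S v b ∧ ¬ Joined S v r => h.1)
      (prox_nonneg (E := E) h0 h1 a r)
    unfold prox at *
    linarith
  rw [prox, expect_insert _ he]
  have h2 : 0 ≤ prox α E v a * (1 - prox α E a r) * prox α E b r + prox α E v b * prox α E a r := by
    have := prox_le_one (E := E) h0 h1 a r
    have := prox_nonneg (E := E) h0 h1 a r
    have := prox_nonneg (E := E) h0 h1 v a
    have := prox_nonneg (E := E) h0 h1 v b
    have := prox_nonneg (E := E) h0 h1 b r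
    have : 0 ≤ 1 - prox α E a r := by linarith
    positivity
  have := mul_le_mul_of_nonneg_left key h0
  have h3 : 0 ≤ 1 - α := by linarith
  have := mul_le_mul_of_nonneg_left h2 h3
  change (1 - α) * prox α E v r + _ ≤ _
  nlinarith

/-- If an edge is removed, then it suffices to add one of its ends as a new root in order to
preserve the proximities to a set of roots up to a factor of two. -/
theorem exists_root_of_insert [Finite V] (h0 : 0 ≤ α) (h1 : α ≤ 1) {e : Sym2 V} (he : e ∉ E)
    [DecidableEq V] {R : Finset V} (hR : R.Nonempty) :
    ∃ b : V, ∀ v, ∀ r ∈ R, ∃ r' ∈ insert b R, prox α (insert e E) v r ≤ 2 * prox α E v r' := by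
  -- By symmetry `a` is the end closer to the roots, with nearest root `r₀`; the other end becomes
  -- the new root.
  suffices H : ∀ a b : V, s(a, b) ∉ E → ∀ r₀ ∈ R, (∀ r ∈ R, prox α E a r ≤ prox α E a r₀) →
      (∀ r ∈ R, prox α E b r ≤ prox α E a r₀) →
      ∀ v, ∀ r ∈ R, ∃ r' ∈ insert b R, prox α (insert s(a, b) E) v r ≤ 2 * prox α E v r' by
    induction e using Sym2.ind with | _ a b => ?_
    obtain ⟨ra, hra, ha⟩ := R.exists_max_image (prox α E a) hR
    obtain ⟨rb, hrb, hb⟩ := R.exists_max_image (prox α E b) hR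
    rcases le_total (prox α E b rb) (prox α E a ra) with h | h
    · exact ⟨b, H a b he ra hra ha fun r hr => (hb r hr).trans h⟩
    · rw [Sym2.eq_swap] at he ⊢
      exact ⟨a, H b a he rb hrb hb fun r hr => (ha r hr).trans h⟩
  intro a b he r₀ hr₀ ha hb v r hr
  have step := prox_insert_le h0 h1 he v r
  set M := prox α E a r₀
  set x := prox α E a r
  set y := prox α E b r
  have hx0 : 0 ≤ x := prox_nonneg h0 h1 a r
  have hx1 : x ≤ 1 := prox_le_one h0 h1 a r
  have hy0 : 0 ≤ y := prox_nonneg h0 h1 b r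
  have hyM : y ≤ M := hb r hr
  have hva : prox α E v a * M ≤ prox α E v r₀ := prox_mul_le h0 h1 v a r₀
  have hbad : prox α E v a * (1 - x) * y ≤ (1 - x) * prox α E v r₀ := by
    have h1x : 0 ≤ 1 - x := by linarith
    calc prox α E v a * (1 - x) * y ≤ prox α E v a * (1 - x) * M :=
          mul_le_mul_of_nonneg_left hyM (mul_nonneg (prox_nonneg h0 h1 v a) h1x)
      _ = (1 - x) * (prox α E v a * M) := by ring
      _ ≤ _ := mul_le_mul_of_nonneg_left hva h1x
  -- With `r'` nearest to `v`, the three terms of `step` are at most `1`, `1 - x` and `x` times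
  -- `prox α E v r'`, using the roots `r`, `r₀` and `b`. This gives the factor two.
  obtain ⟨r', hr', hmax⟩ := (insert b R).exists_max_image (prox α E v) ⟨b, Finset.mem_insert_self b R⟩
  refine ⟨r', hr', ?_⟩
  have m1 := hmax r (Finset.mem_insert_of_mem hr)
  have m2 := mul_le_mul_of_nonneg_left (hmax r₀ (Finset.mem_insert_of_mem hr₀)) (sub_nonneg.2 hx1)
  have m3 := mul_le_mul_of_nonneg_right (hmax b (Finset.mem_insert_self b R)) hx0
  linarith

/-- Deleting the edges of `F` one at a time costs one root and a factor two each. -/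
theorem exists_roots_of_union [Finite V] [DecidableEq V] (h0 : 0 ≤ α) (h1 : α ≤ 1)
    (F : Finset (Sym2 V)) :
    ∀ R : Finset V, R.Nonempty → Disjoint E F →
      ∃ R' : Finset V, R'.card ≤ R.card + F.card ∧
        ∀ v, ∀ r ∈ R, ∃ r' ∈ R', prox α (E ∪ F) v r ≤ 2 ^ F.card * prox α E v r' := by
  induction F using Finset.induction_on with
  | empty =>
    intro R _ _
    exact ⟨R, by simp, fun v r hr => ⟨r, hr, by simp⟩⟩
  | insert e F he ih =>
    intro R hR hd
    obtain ⟨hE, hd⟩ := Finset.disjoint_insert_right.1 hd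
    have heEF : e ∉ E ∪ F := fun h => (Finset.mem_union.1 h).elim hE he
    obtain ⟨b, hb⟩ := exists_root_of_insert h0 h1 heEF hR
    obtain ⟨R', hcard, hR'⟩ := ih (insert b R) ⟨b, Finset.mem_insert_self b R⟩ hd
    refine ⟨R', ?_, fun v r hr => ?_⟩
    · have := Finset.card_insert_le b R
      rw [Finset.card_insert_of_notMem he]
      omega
    · obtain ⟨r₁, hr₁, h₁⟩ := hb v r hr
      obtain ⟨r₂, hr₂, h₂⟩ := hR' v r₁ hr₁
      refine ⟨r₂, hr₂, ?_⟩
      rw [Finset.union_insert, Finset.card_insert_of_notMem he, pow_succ]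
      linarith

/-- Among `k + 2` vertices, two are close in `E` if all vertices are close after the addition of
`k` edges. -/
theorem exists_sq_le_of_union [Finite V] (h0 : 0 ≤ α) (h1 : α ≤ 1) {F : Finset (Sym2 V)}
    (hd : Disjoint E F) {β : ℝ} (hβ0 : 0 ≤ β) (hβ : ∀ u v, β ≤ prox α (E ∪ F) u v)
    {k : ℕ} (hk : F.card ≤ k) (x : Fin (k + 2) → V) :
    ∃ i j, i < j ∧ (β / 2 ^ k) ^ 2 ≤ prox α E (x j) (x i) := by
  classical
  obtain ⟨R, hcard, hR⟩ := exists_roots_of_union h0 h1 F {x 0} (Finset.singleton_nonempty _) hd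
  have hroot : ∀ v, ∃ r ∈ R, β / 2 ^ k ≤ prox α E v r := by
    intro v
    obtain ⟨r, hr, h⟩ := hR v (x 0) (Finset.mem_singleton_self _)
    refine ⟨r, hr, ?_⟩
    rw [div_le_iff₀ (by positivity), mul_comm]
    refine (hβ v (x 0)).trans (h.trans (mul_le_mul_of_nonneg_right ?_ (prox_nonneg h0 h1 v r)))
    exact pow_le_pow_right₀ (by norm_num) hk
  choose ρ hρ hle using hroot
  -- Pigeonhole: one initial root and at most `k` further ones serve `k + 2` vertices.
  obtain ⟨i, -, j, -, hij, heq⟩ := Finset.exists_ne_map_eq_of_card_lt_of_maps_to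
    (s := (Finset.univ : Finset (Fin (k + 2)))) (t := R) (f := fun i => ρ (x i))
    (by rw [Finset.card_singleton] at hcard; rw [Finset.card_univ, Fintype.card_fin]; omega)
    (fun i _ => hρ (x i))
  have key : ∀ i j, ρ (x i) = ρ (x j) → (β / 2 ^ k) ^ 2 ≤ prox α E (x j) (x i) := by
    intro i j heq
    refine le_trans ?_ (prox_mul_le h0 h1 (x j) (ρ (x j)) (x i))
    have hj := hle (x j)
    have hi := hle (x i)
    rw [heq, prox_symm] at hi
    rw [sq]
    exact mul_le_mul hj hi (by positivity) (prox_nonneg h0 h1 _ _)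
  rcases lt_or_gt_of_ne hij with h | h
  · exact ⟨i, j, h, key i j heq⟩
  · exact ⟨j, i, h, key j i heq.symm⟩

end Prox

/-! ### Broadcast and proximities -/

namespace InformationGraph

variable {V : Type*}

theorem proximity_eq_prox [Fintype V] [DecidableEq (Sym2 V)] (G : InformationGraph V) {E : Finset (Sym2 V)}
    (hE : (E : Set (Sym2 V)) = G.graph.edgeSet) (u v : V) :
    G.proximity u v = prox G.α E u v := by
  classical
  unfold proximity prox expect sampleProb
  -- Quantifying over the instance covers whichever one occurs in the unfolded definitions.
  have h : ∀ inst : Fintype G.graph.edgeSet, @SimpleGraph.edgeFinset V G.graph inst = E := by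
    intro inst
    ext e
    rw [SimpleGraph.mem_edgeFinset, ← hE, Finset.mem_coe]
  simp only [h]
  refine Finset.sum_congr rfl fun S _ => ?_
  by_cases hS : Joined S u v
  · rw [ind_of_true hS, mul_one]
    refine (if_pos hS).trans ?_
    congr!
  · rw [ind_of_false hS, mul_zero]
    exact if_neg hS

theorem exists_coe_eq_edgeSet [Fintype V] (G : InformationGraph V) :
    ∃ E : Finset (Sym2 V), (E : Set (Sym2 V)) = G.graph.edgeSet := by
  classical
  exact ⟨G.graph.edgeFinset, by simp⟩

theorem disjoint_of_subset_compl (G : InformationGraph V) {E F : Finset (Sym2 V)}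
    (hE : (E : Set (Sym2 V)) = G.graph.edgeSet)
    (hF : (F : Set (Sym2 V)) ⊆ G.graphᶜ.edgeSet) : Disjoint E F := by
  rw [← Finset.disjoint_coe, hE]
  exact (SimpleGraph.disjoint_edgeSet.2 disjoint_compl_right).mono_right hF

theorem coe_union_eq_edgeSet [DecidableEq (Sym2 V)] (G : InformationGraph V) {E F : Finset (Sym2 V)}
    (hE : (E : Set (Sym2 V)) = G.graph.edgeSet)
    (hF : (F : Set (Sym2 V)) ⊆ G.graphᶜ.edgeSet) :
    ((E ∪ F : Finset (Sym2 V)) : Set (Sym2 V)) = (G.addEdges F).graph.edgeSet := by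
  rw [Finset.coe_union, hE]
  change _ = (G.graph ⊔ SimpleGraph.fromEdgeSet (F : Set (Sym2 V))).edgeSet
  rw [SimpleGraph.edgeSet_sup, SimpleGraph.edgeSet_fromEdgeSet]
  congr 1
  -- `fromEdgeSet` discards loops, but edges of the complement graph are never loops.
  refine (sdiff_eq_left.2 (Set.disjoint_left.2 fun e he => ?_)).symm
  exact SimpleGraph.not_isDiag_of_mem_edgeSet _ (hF he)

theorem broadcast_le [Fintype V] (G : InformationGraph V) (u v : V) : G.broadcast ≤ G.proximity u v :=
  ciInf_le (f := fun p : V × V => G.proximity p.1 p.2) (Set.finite_range _).bddBelow (u, v)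

theorem proximity_le_one [Fintype V] (G : InformationGraph V) (u v : V) : G.proximity u v ≤ 1 := by
  classical
  obtain ⟨E, hE⟩ := G.exists_coe_eq_edgeSet
  rw [G.proximity_eq_prox hE]
  exact prox_le_one G.α_nonneg G.α_le_one u v

theorem proximity_nonneg [Fintype V] (G : InformationGraph V) (u v : V) : 0 ≤ G.proximity u v := by
  classical
  obtain ⟨E, hE⟩ := G.exists_coe_eq_edgeSet
  rw [G.proximity_eq_prox hE]
  exact prox_nonneg G.α_nonneg G.α_le_one u v

theorem proximity_self [Fintype V] (G : InformationGraph V) (u : V) : G.proximity u u = 1 := by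
  classical
  obtain ⟨E, hE⟩ := G.exists_coe_eq_edgeSet
  rw [G.proximity_eq_prox hE, prox_self]

theorem exists_optBroadcast_eq [Fintype V] (G : InformationGraph V) (k : ℕ) :
    ∃ F : Finset (Sym2 V), (F : Set (Sym2 V)) ⊆ G.graphᶜ.edgeSet ∧ F.card ≤ k ∧
      (G.addEdges F).broadcast = G.optBroadcast k := by
  have : Finite (Sym2 V) := Quot.finite _
  have : Finite (Finset (Sym2 V)) := by
    have := Fintype.ofFinite (Sym2 V)
    infer_instance
  have : Nonempty {F : Finset (Sym2 V) // (F : Set (Sym2 V)) ⊆ G.graphᶜ.edgeSet ∧ F.card ≤ k} :=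
    ⟨⟨∅, by simp⟩⟩
  obtain ⟨F, hF⟩ := exists_eq_ciSup_of_finite
    (f := fun F : {F : Finset (Sym2 V) // (F : Set (Sym2 V)) ⊆ G.graphᶜ.edgeSet ∧ F.card ≤ k} =>
      (G.addEdges F.1).broadcast)
  exact ⟨F.1, F.2.1, F.2.2, hF⟩

/-- A lower bound for the largest proximity among `k + 2` vertices. -/
theorem sq_optBroadcast_le [Fintype V] (G : InformationGraph V) {k : ℕ} {r : ℝ} (x : Fin (k + 2) → V)
    (h : ∀ i j, i < j → G.proximity (x j) (x i) ≤ r) :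
    (G.optBroadcast k / 2 ^ k) ^ 2 ≤ r := by
  classical
  obtain ⟨F, hF, hk, hβ⟩ := G.exists_optBroadcast_eq k
  obtain ⟨E, hE⟩ := G.exists_coe_eq_edgeSet
  have hEF := G.coe_union_eq_edgeSet hE hF
  have : Nonempty (V × V) := ⟨(x 0, x 0)⟩
  have h0 : 0 ≤ G.optBroadcast k := by
    rw [← hβ]
    exact le_ciInf fun p => proximity_nonneg _ _ _
  obtain ⟨i, j, hij, hle⟩ := exists_sq_le_of_union G.α_nonneg G.α_le_one
    (G.disjoint_of_subset_compl hE hF) h0 (fun u v => by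
      rw [← hβ]
      exact (broadcast_le _ u v).trans (proximity_eq_prox _ hEF u v).le) hk x
  rw [← G.proximity_eq_prox hE] at hle
  exact hle.trans (h i j hij)

/-- The broadcast after linking a set of centers to a common vertex. -/
theorem le_broadcast_addEdges_star [Fintype V] (G : InformationGraph V) {F : Finset (Sym2 V)}
    (hF : (F : Set (Sym2 V)) ⊆ G.graphᶜ.edgeSet) (z : V) {r : ℝ} (hr : 0 ≤ r)
    (h : ∀ v, ∃ c, r ≤ G.proximity v c ∧ (c = z ∨ G.graph.Adj z c ∨ s(z, c) ∈ F)) :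
    r ^ 2 * G.α ^ 2 ≤ (G.addEdges F).broadcast := by
  classical
  obtain ⟨E, hE⟩ := G.exists_coe_eq_edgeSet
  have hEF := G.coe_union_eq_edgeSet hE hF
  have h0 := G.α_nonneg
  have h1 := G.α_le_one
  have key : ∀ v, r * G.α ≤ prox G.α (E ∪ F) v z := by
    intro v
    obtain ⟨c, hc, hz⟩ := h v
    rw [G.proximity_eq_prox hE] at hc
    have hvc := hc.trans (prox_mono h0 h1 (Finset.subset_union_left (s₂ := F)) v c)
    have hcz : G.α ≤ prox G.α (E ∪ F) c z := by
      rw [prox_symm]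
      rcases hz with rfl | hz | hz
      · rwa [prox_self]
      · refine le_prox_of_mem h0 h1 (Finset.mem_union_left _ ?_)
        rw [← Finset.mem_coe, hE]
        exact hz
      · exact le_prox_of_mem h0 h1 (Finset.mem_union_right _ hz)
    exact (mul_le_mul hvc hcz h0 (prox_nonneg h0 h1 v c)).trans (prox_mul_le h0 h1 v c z)
  have : Nonempty (V × V) := ⟨(z, z)⟩
  refine le_ciInf fun p => ?_
  rw [(G.addEdges F).proximity_eq_prox hEF]
  change _ ≤ prox G.α (E ∪ F) p.1 p.2
  refine le_trans ?_ (prox_mul_le h0 h1 p.1 z p.2)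
  have a := key p.1
  have b := key p.2
  rw [prox_symm] at b
  calc r ^ 2 * G.α ^ 2 = (r * G.α) * (r * G.α) := by ring
    _ ≤ _ := mul_le_mul a b (mul_nonneg hr h0) (prox_nonneg h0 h1 p.1 z)

end InformationGraph

/-! ### Farthest-first traversal -/

section Traversal

variable {n : ℕ}

/-- The state of a farthest-first traversal after `j` rounds: `c 0, …, c j` are the centers, `m v`
is a center nearest to `v`, and `out` lists the edges from `c 0` to further centers. -/
structure Traversal (G : InformationGraph (Fin n)) (j : ℕ) (c : ℕ → Fin n) (m : Fin n → Fin n)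
    (out : List (Fin n × Fin n)) : Prop where
  mem_centers : ∀ v, ∃ i ≤ j, m v = c i
  nearest : ∀ v, ∀ i ≤ j, G.proximity v (c i) ≤ G.proximity v (m v)
  separated : ∀ i ≤ j, ∀ i' < i, ∀ v, G.proximity (c i) (c i') ≤ G.proximity v (m v)
  length_le : out.length ≤ j
  not_adj : ∀ e ∈ out, e.1 ≠ e.2 ∧ ¬ G.graph.Adj e.1 e.2
  linked : ∀ i ≤ j, c i = c 0 ∨ G.graph.Adj (c 0) (c i) ∨ (c 0, c i) ∈ out

namespace Traversal

variable {G : InformationGraph (Fin n)} {j : ℕ} {c : ℕ → Fin n} {m : Fin n → Fin n}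
  {out : List (Fin n × Fin n)}

theorem init (G : InformationGraph (Fin n)) (z : Fin n) :
    Traversal G 0 (fun _ => z) (fun _ => z) [] where
  mem_centers _ := ⟨0, le_rfl, rfl⟩
  nearest _ _ _ := le_rfl
  separated i hi i' hi' := by omega
  length_le := le_rfl
  not_adj := by simp
  linked _ _ := Or.inl rfl

open Classical in
/-- The assignment of nearest centers after the addition of the center `w`. -/
noncomputable def update (G : InformationGraph (Fin n)) (m : Fin n → Fin n) (w v : Fin n) :
    Fin n :=
  if G.proximity v (m v) < G.proximity v w then w else m v

theorem le_update (G : InformationGraph (Fin n)) (m : Fin n → Fin n) (w v : Fin n) :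
    G.proximity v (m v) ≤ G.proximity v (update G m w v) := by
  unfold update
  split_ifs with h
  · exact h.le
  · exact le_rfl

theorem le_update_self (G : InformationGraph (Fin n)) (m : Fin n → Fin n) (w v : Fin n) :
    G.proximity v w ≤ G.proximity v (update G m w v) := by
  unfold update
  split_ifs with h
  · exact le_rfl
  · exact not_lt.1 h

/-- Proximities to nearest centers only grow, so old separation bounds survive; for the new center
they follow from the greedy choice `hw`. No edge is output if `w` is the hub or already adjacent to
it, since only new edges are allowed. -/
theorem step (h : Traversal G j c m out) {w : Fin n}
    (hw : ∀ v, G.proximity w (m w) ≤ G.proximity v (m v)) {out' : List (Fin n × Fin n)}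
    (hout : (out' = out ∧ (w = c 0 ∨ G.graph.Adj (c 0) w)) ∨
      (out' = out ++ [(c 0, w)] ∧ w ≠ c 0 ∧ ¬ G.graph.Adj (c 0) w)) :
    Traversal G (j + 1) (Function.update c (j + 1) w) (update G m w) out' := by
  have hc : ∀ i ≤ j, Function.update c (j + 1) w i = c i := fun i hi =>
    Function.update_of_ne (by omega) _ _
  have hc' : Function.update c (j + 1) w (j + 1) = w := Function.update_self _ _ _
  refine ⟨fun v => ?_, fun v i hi => ?_, fun i hi i' hi' v => ?_, ?_, ?_, fun i hi => ?_⟩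
  · unfold update
    split_ifs
    · exact ⟨j + 1, le_rfl, hc'.symm⟩
    · obtain ⟨i, hi, h⟩ := h.mem_centers v
      exact ⟨i, by omega, by rw [h, hc i hi]⟩
  · rcases Nat.lt_or_eq_of_le hi with hi | rfl
    · rw [hc i (by omega)]
      exact (h.nearest v i (by omega)).trans (le_update G m w v)
    · rw [hc']
      exact le_update_self G m w v
  · refine le_trans ?_ (le_update G m w v)
    rw [hc i' (by omega)]
    rcases Nat.lt_or_eq_of_le hi with hi | rfl
    · rw [hc i (by omega)]
      exact h.separated i (by omega) i' hi' v
    · rw [hc']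
      exact (h.nearest w i' (by omega)).trans (hw v)
  · have := h.length_le
    rcases hout with ⟨rfl, -⟩ | ⟨rfl, -⟩
    · omega
    · simpa using this
  · rcases hout with ⟨rfl, -⟩ | ⟨rfl, hne, hadj⟩
    · exact h.not_adj
    · intro e he
      rcases List.mem_append.1 he with he | he
      · exact h.not_adj e he
      · rw [List.mem_singleton.1 he]
        exact ⟨hne.symm, hadj⟩
  · rw [hc 0 (Nat.zero_le j)]
    rcases Nat.lt_or_eq_of_le hi with hi | rfl
    · rw [hc i (by omega)]
      have := h.linked i (by omega)
      rcases hout with ⟨rfl, -⟩ | ⟨rfl, -⟩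
      · exact this
      · exact this.imp_right (Or.imp_right (List.mem_append_left _))
    · rw [hc']
      rcases hout with ⟨rfl, hadj⟩ | ⟨rfl, -⟩
      · exact hadj.imp_right Or.inl
      · exact Or.inr (Or.inr (by simp))

/-- The guarantee of the farthest-first traversal. -/
theorem le_broadcast {k : ℕ} (h : Traversal G (min k n) c m out) {F : Finset (Sym2 (Fin n))}
    (hF : F = (out.map fun e => s(e.1, e.2)).toFinset) :
    (F : Set (Sym2 (Fin n))) ⊆ G.graphᶜ.edgeSet ∧ F.card ≤ k ∧
      (G.optBroadcast k) ^ 4 * G.α ^ 2 / 16 ^ (k + 1) ≤ (G.addEdges F).broadcast := by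
  have hsub : (F : Set (Sym2 (Fin n))) ⊆ G.graphᶜ.edgeSet := by
    intro e he
    rw [hF, List.coe_toFinset] at he
    obtain ⟨d, hd, rfl⟩ := List.mem_map.1 he
    exact h.not_adj d hd
  refine ⟨hsub, ?_, ?_⟩
  · rw [hF]
    refine (List.toFinset_card_le _).trans ?_
    rw [List.length_map]
    exact h.length_le.trans (min_le_left _ _)
  obtain ⟨w, -, hw⟩ := Finset.exists_min_image (Finset.univ : Finset (Fin n))
    (fun v => G.proximity v (m v)) ⟨c 0, Finset.mem_univ _⟩
  have hstar := G.le_broadcast_addEdges_star hsub (c 0) (G.proximity_nonneg w (m w)) fun v => by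
    obtain ⟨i, hi, hmi⟩ := h.mem_centers v
    refine ⟨m v, hw v (Finset.mem_univ v), ?_⟩
    rw [hmi]
    refine (h.linked i hi).imp_right (Or.imp_right fun h => ?_)
    rw [hF, List.mem_toFinset]
    exact List.mem_map.2 ⟨_, h, rfl⟩
  refine le_trans ?_ hstar
  have hr : (G.optBroadcast k / 2 ^ k) ^ 2 ≤ G.proximity w (m w) := by
    rcases le_total k n with hkn | hkn
    · rw [min_eq_left hkn] at h
      -- The `k + 1` centers followed by the farthest vertex `w`.
      refine G.sq_optBroadcast_le (fun i : Fin (k + 2) => if (i : ℕ) ≤ k then c i else w)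
        fun i j hij => ?_
      have hij' : (i : ℕ) < j := hij
      have hj := j.2
      rw [if_pos (by omega : (i : ℕ) ≤ k)]
      split_ifs with hjk
      · exact h.separated j hjk i hij w
      · exact h.nearest w i (by omega)
    · rw [min_eq_right hkn] at h
      -- Among `n + 1` centers on `n` vertices two coincide, and separation then forces every vertex
      -- to have proximity one to its center.
      have h1 : 1 ≤ G.proximity w (m w) := by
        obtain ⟨i, j, hij, heq⟩ := Fintype.exists_ne_map_eq_of_card_lt
          (fun i : Fin (n + 1) => c i) (by simp)
        rcases lt_or_gt_of_ne hij with hij | hij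
        · have := h.separated j (by omega) i hij w
          rwa [← heq, G.proximity_self] at this
        · have := h.separated i (by omega) j hij w
          rwa [← heq, G.proximity_self] at this
      exact G.sq_optBroadcast_le (fun _ => w) fun _ _ _ => (G.proximity_le_one _ _).trans h1
  have h2 := mul_le_mul_of_nonneg_right (pow_le_pow_left₀ (sq_nonneg _) hr 2) (sq_nonneg G.α)
  refine le_trans ?_ h2
  have h16 : (16 : ℝ) ^ k = ((2 ^ k) ^ 2) ^ 2 := by
    rw [← pow_mul, ← pow_mul, mul_comm, pow_mul]; norm_num
  have : ((G.optBroadcast k / 2 ^ k) ^ 2) ^ 2 * G.α ^ 2 =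
      (G.optBroadcast k) ^ 4 * G.α ^ 2 / 16 ^ k := by
    rw [h16, div_pow, div_pow]; ring
  rw [this]
  -- The argument yields the denominator `16 ^ k`; a factor `16` is given away.
  refine div_le_div_of_nonneg_left (by positivity) (by positivity) ?_
  exact pow_le_pow_right₀ (by norm_num) (Nat.le_succ k)

end Traversal

end Traversal

/-! ### Verification of programs -/

variable {n : ℕ} {G : InformationGraph (Fin n)}

/-- Started in `s`, the program `P` halts after at most `T` steps in a state that satisfies `Q`. -/
def Runs (G : InformationGraph (Fin n)) (P : Program) (s : State) (T : ℕ) (Q : State → Prop) :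
    Prop :=
  ∃ t s', Exec G P s t s' ∧ t ≤ T ∧ Q s'

namespace Runs

variable {P P' : Program} {s : State} {T T' : ℕ} {Q Q' : State → Prop} {b : Test}

theorem mono (h : Runs G P s T Q) (hT : T ≤ T') (hQ : ∀ s, Q s → Q' s) : Runs G P s T' Q' := by
  obtain ⟨t, s', he, ht, hq⟩ := h
  exact ⟨t, s', he, ht.trans hT, hQ s' hq⟩

theorem skip (h : Q s) : Runs G .skip s 0 Q := ⟨0, s, .skip s, le_rfl, h⟩

theorem instr {i : Instr} (h : Q (i.apply G s)) : Runs G (.instr i) s 1 Q :=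
  ⟨1, _, .instr i s, le_rfl, h⟩

theorem seq (h : Runs G P s T fun s' => Runs G P' s' T' Q) :
    Runs G (.seq P P') s (T + T') Q := by
  obtain ⟨t, s', he, ht, t', s'', he', ht', hq⟩ := h
  exact ⟨_, s'', .seq he he', add_le_add ht ht', hq⟩

theorem instr_seq {i : Instr} (h : Runs G P (i.apply G s) T Q) :
    Runs G (.seq (.instr i) P) s (T + 1) Q :=
  (seq (instr h)).mono (by omega) fun _ h => h

theorem ite (h : b.Holds s → Runs G P s T Q) (h' : ¬ b.Holds s → Runs G P' s T Q) :
    Runs G (.ite b P P') s (T + 1) Q := by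
  by_cases hb : b.Holds s
  · obtain ⟨t, s', he, ht, hq⟩ := h hb
    exact ⟨_, s', .ite_true hb he, Nat.succ_le_succ ht, hq⟩
  · obtain ⟨t, s', he, ht, hq⟩ := h' hb
    exact ⟨_, s', .ite_false hb he, Nat.succ_le_succ ht, hq⟩

/-- A loop with an invariant `I` indexed by the number of iterations. -/
theorem loop (I : ℕ → State → Prop) (N : ℕ) (h0 : I 0 s)
    (hstep : ∀ i < N, ∀ s, I i s → b.Holds s ∧ Runs G P s T (I (i + 1)))
    (hN : ∀ s, I N s → ¬ b.Holds s) :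
    Runs G (.while b P) s (N * (T + 1) + 1) (I N) := by
  suffices H : ∀ d i s, i + d = N → I i s → Runs G (.while b P) s (d * (T + 1) + 1) (I N) from
    H N 0 s (Nat.zero_add N) h0
  intro d
  induction d with
  | zero =>
    rintro i s rfl h
    exact ⟨1, s, .while_false (hN s h), by omega, h⟩
  | succ d ih =>
    intro i s hi h
    obtain ⟨hb, t, s', he, ht, hI⟩ := hstep i (by omega) s h
    obtain ⟨t', s'', he', ht', hI'⟩ := ih (i + 1) s' (by omega) hI
    refine ⟨_, s'', .while_true hb he he', ?_, hI'⟩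
    rw [Nat.succ_mul]
    omega

end Runs

theorem adjQuery_coe (u v : Fin n) : adjQuery G u v = 0 ↔ ¬ G.graph.Adj u v := by
  simp [adjQuery]

theorem proxQuery_coe (u v : Fin n) : proxQuery G u v = G.proximity u v := by
  simp [proxQuery]

/-! ### The program for the farthest-first traversal

Register `0` holds the number of vertices, `2` the round, `3` the number of rounds, `4` and `9` the
constants one and zero, `5` the vertex of an inner loop, `6` the new center; the memory holds the
nearest centers. -/

/-- Find a vertex with least proximity to its nearest center. -/
def farthestBody : Program :=
  .seq (.instr (.load 7 5)) <| .seq (.instr (.prox 2 5 7)) <|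
  .seq (.ite (.ltReal 2 1) (.seq (.instr (.moveReal 1 2)) (.instr (.move 6 5))) .skip) <|
  .instr (.add 5 5 4)

/-- Update the nearest centers. -/
def updateBody : Program :=
  .seq (.instr (.load 7 5)) <| .seq (.instr (.prox 1 5 7)) <| .seq (.instr (.prox 2 5 6)) <|
  .seq (.ite (.ltReal 1 2) (.instr (.store 5 6)) .skip) <|
  .instr (.add 5 5 4)

/-- One round of the traversal. -/
def roundBody : Program :=
  .seq (.instr (.const 5 0)) <| .seq (.instr (.const 6 0)) <| .seq (.instr (.load 7 6)) <|
  .seq (.instr (.prox 1 6 7)) <|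
  .seq (.while (.lt 5 0) farthestBody) <|
  .seq (.instr (.adj 8 9 6)) <|
  .seq (.ite (.eq 8 9) (.ite (.eq 6 9) .skip (.instr (.emit 9 6))) .skip) <|
  .seq (.instr (.const 5 0)) <|
  .seq (.while (.lt 5 0) updateBody) <|
  .instr (.add 2 2 4)

/-- The farthest-first traversal with `min k n` rounds. -/
def traversalProgram : Program :=
  .seq (.instr (.const 4 1)) <|
  .seq (.ite (.lt 1 0) (.instr (.move 3 1)) (.instr (.move 3 0))) <|
  .while (.lt 2 3) roundBody

/-- The part of the program state that the inner loops only read, apart from the memory. -/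
structure Frame (n j N : ℕ) (out : List (ℕ × ℕ)) (s : State) : Prop where
  reg0 : s.reg 0 = n
  reg2 : s.reg 2 = j
  reg3 : s.reg 3 = N
  reg4 : s.reg 4 = 1
  reg9 : s.reg 9 = 0
  out_eq : s.out = out

variable {j N : ℕ} {out : List (ℕ × ℕ)} {m : Fin n → Fin n} {s : State}

/-- Register `6` and real register `1` carry the best vertex so far and its value. A program cannot
write an arbitrary real constant, so the search starts from an actual vertex `z`. A pass takes at
most six steps and one test. -/
theorem runs_farthest (hs : Frame n j N out s) (hm : ∀ v : Fin n, s.mem v = m v)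
    (h5 : s.reg 5 = 0) {z : Fin n} (h6 : s.reg 6 = z)
    (hr : s.real 1 = G.proximity z (m z)) :
    Runs G (.while (.lt 5 0) farthestBody) s (n * 7 + 1) fun s' =>
      Frame n j N out s' ∧ (∀ v : Fin n, s'.mem v = m v) ∧
        ∃ w : Fin n, s'.reg 6 = w ∧ ∀ v, G.proximity w (m w) ≤ G.proximity v (m v) := by
  have key := Runs.loop (G := G) (s := s) (b := .lt 5 0) (P := farthestBody) (T := 6)
    (fun i s => Frame n j N out s ∧ (∀ v : Fin n, s.mem v = m v) ∧ s.reg 5 = i ∧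
      ∃ w : Fin n, s.reg 6 = w ∧ s.real 1 = G.proximity w (m w) ∧
        ∀ v : Fin n, (v : ℕ) < i → G.proximity w (m w) ≤ G.proximity v (m v)) n
    ⟨hs, hm, h5, z, h6, hr, fun v hv => absurd hv (Nat.not_lt_zero _)⟩ ?_ ?_
  · refine key.mono (by omega) ?_
    rintro s' ⟨hs', hm', -, w, hw, -, hmin⟩
    exact ⟨hs', hm', w, hw, fun v => hmin v v.2⟩
  · rintro i hi s ⟨hs, hm, h5, w, h6, hr, hmin⟩
    obtain ⟨a0, a2, a3, a4, a9, ao⟩ := hs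
    refine ⟨by simpa [Test.Holds, h5, a0] using hi, ?_⟩
    lift i to Fin n using hi with u
    unfold farthestBody
    refine Runs.mono (T := 6) (Runs.instr_seq (Runs.instr_seq (T := 4) ?_)) (by omega)
      fun _ h => h
    have e : proxQuery G (u : ℕ) (s.mem (u : ℕ)) = G.proximity u (m u) := by
      rw [hm, proxQuery_coe]
    refine Runs.seq (T := 3) (T' := 1) (Runs.ite (T := 2) ?_ ?_)
    · intro hb
      have hb' : G.proximity u (m u) < G.proximity w (m w) := by
        simpa [Test.Holds, Instr.apply, h5, hr, e] using hb
      refine Runs.instr_seq (Runs.instr (Runs.instr ?_))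
      refine ⟨?_, ?_, ?_, u, ?_, ?_, ?_⟩
      · constructor <;> simp [Instr.apply, *]
      · simpa [Instr.apply] using hm
      · simp [Instr.apply, h5, a4]
      · simp [Instr.apply, h5]
      · simp [Instr.apply, h5, e]
      · intro v hv
        rcases Nat.lt_succ_iff_lt_or_eq.1 hv with hv | hv
        · exact hb'.le.trans (hmin v hv)
        · rw [Fin.ext hv]
    · intro hb
      have hb' : G.proximity w (m w) ≤ G.proximity u (m u) := by
        simpa [Test.Holds, Instr.apply, h5, hr, e] using hb
      refine Runs.mono (Runs.skip (Runs.instr ?_)) (by omega) fun _ h => h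
      refine ⟨?_, ?_, ?_, w, ?_, ?_, ?_⟩
      · constructor <;> simp [Instr.apply, *]
      · simpa [Instr.apply] using hm
      · simp [Instr.apply, h5, a4]
      · simp [Instr.apply, h6]
      · simp [Instr.apply, hr]
      · intro v hv
        rcases Nat.lt_succ_iff_lt_or_eq.1 hv with hv | hv
        · exact hmin v hv
        · rw [Fin.ext hv]; exact hb'
  · rintro s ⟨hs, -, h5, -⟩
    simp [Test.Holds, h5, hs.reg0]

/-- Updating in place is safe because the new entry of a vertex depends only on its own old entry
and `w`. Entries below the loop counter are new, the others old. -/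
theorem runs_update (hs : Frame n j N out s) (hm : ∀ v : Fin n, s.mem v = m v)
    (h5 : s.reg 5 = 0) {w : Fin n} (h6 : s.reg 6 = w) :
    Runs G (.while (.lt 5 0) updateBody) s (n * 7 + 1) fun s' =>
      Frame n j N out s' ∧ ∀ v : Fin n, s'.mem v = Traversal.update G m w v := by
  have key := Runs.loop (G := G) (s := s) (b := .lt 5 0) (P := updateBody) (T := 6)
    (fun i s => Frame n j N out s ∧ s.reg 5 = i ∧ s.reg 6 = w ∧
      (∀ v : Fin n, (v : ℕ) < i → s.mem v = Traversal.update G m w v) ∧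
      ∀ v : Fin n, i ≤ (v : ℕ) → s.mem v = m v) n
    ⟨hs, h5, h6, fun v hv => absurd hv (Nat.not_lt_zero _), fun v _ => hm v⟩ ?_ ?_
  · refine key.mono (by omega) ?_
    rintro s' ⟨hs', -, -, hlt, -⟩
    exact ⟨hs', fun v => hlt v v.2⟩
  · rintro i hi s ⟨hs, h5, h6, hlt, hge⟩
    obtain ⟨a0, a2, a3, a4, a9, ao⟩ := hs
    refine ⟨by simpa [Test.Holds, h5, a0] using hi, ?_⟩
    lift i to Fin n using hi with u
    unfold updateBody
    refine Runs.mono (T := 6)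
      (Runs.instr_seq (Runs.instr_seq (Runs.instr_seq (T := 3) ?_))) (by omega) fun _ h => h
    have e : proxQuery G (u : ℕ) (s.mem (u : ℕ)) = G.proximity u (m u) := by
      rw [hge u le_rfl, proxQuery_coe]
    refine Runs.seq (T := 2) (T' := 1) (Runs.ite (T := 1) ?_ ?_)
    · intro hb
      have hb' : G.proximity u (m u) < G.proximity u w := by
        simpa [Test.Holds, Instr.apply, h5, h6, e, proxQuery_coe] using hb
      refine Runs.instr (Runs.instr ⟨?_, ?_, ?_, ?_, ?_⟩)
      · constructor <;> simp [Instr.apply, *]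
      · simp [Instr.apply, h5, a4]
      · simp [Instr.apply, h6]
      · intro v hv
        rcases Nat.lt_succ_iff_lt_or_eq.1 hv with hv | hv
        · simpa [Instr.apply, h5, h6, Function.update_of_ne hv.ne] using hlt v hv
        · simp [Instr.apply, h5, h6, Fin.ext hv, Traversal.update, hb']
      · intro v hv
        have : (v : ℕ) ≠ u := by omega
        simpa [Instr.apply, h5, h6, Function.update_of_ne this] using hge v (by omega)
    · intro hb
      have hb' : ¬ G.proximity u (m u) < G.proximity u w := by
        simpa [Test.Holds, Instr.apply, h5, h6, e, proxQuery_coe] using hb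
      refine Runs.mono (Runs.skip (Runs.instr ⟨?_, ?_, ?_, ?_, ?_⟩)) (by omega) fun _ h => h
      · constructor <;> simp [Instr.apply, *]
      · simp [Instr.apply, h5, a4]
      · simp [Instr.apply, h6]
      · intro v hv
        rcases Nat.lt_succ_iff_lt_or_eq.1 hv with hv | hv
        · simpa [Instr.apply] using hlt v hv
        · simpa [Instr.apply, Fin.ext hv, Traversal.update, hb'] using hge u le_rfl
      · intro v hv
        simpa [Instr.apply] using hge v (by omega)
  · rintro s ⟨hs, h5, -⟩
    simp [Test.Holds, h5, hs.reg0]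

/-- The loop invariant of the traversal. -/
def RoundInvariant (G : InformationGraph (Fin n)) (N j : ℕ) (s : State) : Prop :=
  ∃ c m out, Traversal G j c m out ∧ (c 0 : ℕ) = 0 ∧
    Frame n j N (out.map fun e => ((e.1 : ℕ), (e.2 : ℕ))) s ∧ ∀ v : Fin n, s.mem v = m v

theorem runs_round (h : RoundInvariant G N j s) :
    Runs G roundBody s (n * 14 + 12) (RoundInvariant G N (j + 1)) := by
  obtain ⟨c, m, out, ht, hc, hs, hm⟩ := h
  have h0 : s.mem 0 = m (c 0) := by rw [← hm, hc]
  obtain ⟨a0, a2, a3, a4, a9, ao⟩ := hs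
  unfold roundBody
  refine Runs.mono (T := (n * 7 + 1 + (3 + (n * 7 + 1 + 1) + 1 + 1)) + 1 + 1 + 1 + 1) ?_ (by omega)
    fun _ h => h
  refine Runs.instr_seq (Runs.instr_seq (Runs.instr_seq (Runs.instr_seq ?_)))
  refine Runs.seq ((runs_farthest (j := j) (N := N) (m := m) (z := c 0)
    (out := out.map fun e => ((e.1 : ℕ), (e.2 : ℕ))) ?_ ?_ ?_ ?_ ?_).mono le_rfl ?_)
  · constructor <;> simp [Instr.apply, *]
  · simpa [Instr.apply] using hm
  · simp [Instr.apply]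
  · simp [Instr.apply, hc]
  · have := proxQuery_coe (G := G) (c 0) (m (c 0))
    rw [hc] at this
    simp [Instr.apply, h0, this]
  clear a0 a2 a3 a4 a9 ao hm h0
  rintro s ⟨⟨a0, a2, a3, a4, a9, ao⟩, hm, w, h6, hw⟩
  -- The rest of the round, common to the three branches: `w` is the hub, `w` is linked by a new
  -- edge, or `w` is already adjacent to the hub.
  have finish : ∀ (s : State) (out' : List (Fin n × Fin n)),
      Frame n j N (out'.map fun e => ((e.1 : ℕ), (e.2 : ℕ))) s → (∀ v : Fin n, s.mem v = m v) →
      s.reg 6 = w →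
      ((out' = out ∧ (w = c 0 ∨ G.graph.Adj (c 0) w)) ∨
        (out' = out ++ [(c 0, w)] ∧ w ≠ c 0 ∧ ¬ G.graph.Adj (c 0) w)) →
      Runs G (.seq (.instr (.const 5 0)) <| .seq (.while (.lt 5 0) updateBody) <|
        .instr (.add 2 2 4)) s (n * 7 + 1 + 1 + 1) (RoundInvariant G N (j + 1)) := by
    intro s out' hs hm h6 hout
    obtain ⟨a0, a2, a3, a4, a9, ao⟩ := hs
    refine Runs.instr_seq (Runs.seq (T := n * 7 + 1) (T' := 1) ((runs_update (j := j) (N := N) (m := m) (w := w)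
      (out := out'.map fun e => ((e.1 : ℕ), (e.2 : ℕ))) ?_ ?_ ?_ ?_).mono le_rfl ?_))
    · constructor <;> simp [Instr.apply, *]
    · simpa [Instr.apply] using hm
    · simp [Instr.apply]
    · simp [Instr.apply, h6]
    · rintro s ⟨⟨a0, a2, a3, a4, a9, ao⟩, hm⟩
      refine Runs.instr ⟨_, _, out', ht.step hw hout, ?_, ?_, ?_⟩
      · rw [Function.update_of_ne (by omega), hc]
      · constructor <;> simp [Instr.apply, *]
      · simpa [Instr.apply] using hm
  have e : adjQuery G 0 w = 0 ↔ ¬ G.graph.Adj (c 0) w := by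
    rw [← adjQuery_coe, hc]
  refine Runs.mono (T := (3 + (n * 7 + 1 + 1 + 1)) + 1) ?_ (by omega) fun _ h => h
  refine Runs.instr_seq (Runs.seq (Runs.ite (T := 2) (fun h8 => Runs.ite (T := 1) ?_ ?_) ?_))
  · intro h6'
    refine Runs.mono (Runs.skip (finish _ out ?_ ?_ ?_ (Or.inl ⟨rfl, Or.inl ?_⟩))) (by omega)
      fun _ h => h
    · constructor <;> simp [Instr.apply, *]
    · simpa [Instr.apply] using hm
    · simp [Instr.apply, h6]
    · have : (w : ℕ) = 0 := by simpa [Test.Holds, Instr.apply, h6, a9] using h6'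
      exact Fin.ext (this.trans hc.symm)
  · intro h6'
    refine Runs.instr (finish _ (out ++ [(c 0, w)]) ?_ ?_ ?_ (Or.inr ⟨rfl, ?_, ?_⟩))
    · constructor <;> simp [Instr.apply, *]
    · simpa [Instr.apply] using hm
    · simp [Instr.apply, h6]
    · rintro rfl
      exact h6' (by simp [Test.Holds, Instr.apply, h6, a9, hc])
    · rw [← e]
      simpa [Test.Holds, Instr.apply, h6, a9] using h8
  · intro h8
    refine Runs.mono (Runs.skip (finish _ out ?_ ?_ ?_ (Or.inl ⟨rfl, Or.inr ?_⟩))) (by omega)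
      fun _ h => h
    · constructor <;> simp [Instr.apply, *]
    · simpa [Instr.apply] using hm
    · simp [Instr.apply, h6]
    · by_contra hadj
      exact h8 (by simpa [Test.Holds, Instr.apply, h6, a9] using e.2 hadj)

theorem runs_traversal (hn : 0 < n) (G : InformationGraph (Fin n)) (k : ℕ) :
    Runs G traversalProgram (initState G k) (n * (n * 14 + 12 + 1) + 4)
      (RoundInvariant G (min k n) (min k n)) := by
  unfold traversalProgram
  refine Runs.mono (T := 2 + (min k n * (n * 14 + 12 + 1) + 1) + 1) ?_ ?_ fun _ h => h
  · have hloop : ∀ s : State, s.reg 0 = n → s.reg 2 = 0 → s.reg 3 = min k n → s.reg 4 = 1 →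
        s.reg 9 = 0 → s.out = [] → (∀ v : Fin n, s.mem v = 0) →
        Runs G (.while (.lt 2 3) roundBody) s (min k n * (n * 14 + 12 + 1) + 1)
          (RoundInvariant G (min k n) (min k n)) := by
      intro s a0 a2 a3 a4 a9 ao hm
      refine Runs.loop (RoundInvariant G (min k n)) (min k n) ?_ ?_ ?_
      -- The all-zero memory already assigns every vertex to the center `0`.
      · exact ⟨_, _, _, Traversal.init G ⟨0, hn⟩, rfl, ⟨a0, a2, a3, a4, a9, ao⟩, hm⟩
      · intro i hi s hs
        refine ⟨?_, runs_round hs⟩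
        obtain ⟨c, m, out, -, -, hf, -⟩ := hs
        simpa only [Test.Holds, hf.reg2, hf.reg3] using hi
      · rintro s ⟨c, m, out, -, -, hf, -⟩
        simp [Test.Holds, hf.reg2, hf.reg3]
    refine Runs.instr_seq (Runs.seq (Runs.ite (T := 1) ?_ ?_))
    · intro hb
      have : k < n := by simpa [Test.Holds, Instr.apply, initState] using hb
      refine Runs.instr (hloop _ ?_ ?_ ?_ ?_ ?_ ?_ ?_) <;>
        simp [Instr.apply, initState, this.le]
    · intro hb
      have : n ≤ k := by simpa [Test.Holds, Instr.apply, initState] using hb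
      refine Runs.instr (hloop _ ?_ ?_ ?_ ?_ ?_ ?_ ?_) <;>
        simp [Instr.apply, initState, this]
  · have := Nat.mul_le_mul_right (n * 14 + 12 + 1) (min_le_right k n)
    omega

end BroadcastImprovement

theorem mainTheorem2 :
    ∃ (A : Program) (p : Polynomial ℕ),
      ∀ (n : ℕ) (G : InformationGraph (Fin n)) (k : ℕ),
        ∃ (t : ℕ) (F : Finset (Sym2 (Fin n))),
          A.Outputs G k t F ∧
          t ≤ p.eval n ∧
          (F : Set (Sym2 (Fin n))) ⊆ G.graphᶜ.edgeSet ∧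
          F.card ≤ k ∧
          (G.optBroadcast k) ^ 4 * G.α ^ 2 / 16 ^ (k + 1) ≤ (G.addEdges F).broadcast := by
  refine ⟨traversalProgram,
    Polynomial.X * (Polynomial.X * Polynomial.C 14 + Polynomial.C 12 + Polynomial.C 1) + Polynomial.C 4,
    fun n G k => ?_⟩
  have hn : 0 < n := Fin.pos_iff_nonempty.2 G.connected.nonempty
  obtain ⟨t, s, hexec, ht, c, m, out, htrav, -, hframe, -⟩ := runs_traversal hn G k
  refine ⟨t, (out.map fun e => s(e.1, e.2)).toFinset, ⟨s, hexec, out, hframe.out_eq, rfl⟩, ?_,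
    htrav.le_broadcast rfl⟩
  simpa only [Polynomial.eval_add, Polynomial.eval_mul, Polynomial.eval_X, Polynomial.eval_C]
    using ht
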